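/- Consider the following homogeneous cellular network. The base stations (BS) form a simple, locally finite point process $\Phi=\{X_n\}_{n\in\mathbb Z}$ on $\mathbb R^2$ with intensity $\lambda\in(0,\infty)$, stationary and ergodic. It carries powers $P_n>0$, shadowing fields $S_n(\cdot)>0$ on $\mathbb R^2$ and interference factors $\varphi_n\in[0,1]$, which are marks of $\Phi$ (the marked point process is stationary); $\{P_n\}$ are i.i.d. marks, $\{S_n\}$ are i.i.d. marks (each sequence being independent of the locations), and $\{\varphi_n\}$ are arbitrary marks. For $K>0$, $\beta>2$, the propagation loss is $L_{X_n}(y)=(K|y-X_n|)^\beta/(P_nS_n(y-X_n))$, the cell of $X\in\Phi$ is $V(X)=\{y: L_X(y)\le L_Y(y)\ \forall\, Y\in\Phi\}$, and for $y\in V(X)$, with noise power $N\ge 0$, $$\mathrm{SINR}(y,\Phi)=\frac{1/L_X(y)}{N+\sum_{Y\in\Phi\setminus\{X\}}\varphi_Y/L_Y(y)} .$$ Given a traffic demand $\rho>0$ per unit of surface and a (measurable, nonnegative) peak bit-rate function $R$ of the SINR, the traffic demand to the cell of $X$ and its load are $$\rho(X)=\rho\,|V(X)|,\qquad \theta(X)=\rho\int_{V(X)}\frac{dy}{R(\mathrm{SINR}(y,\Phi))}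 .$$ Let $\mathbf E^0$ be the expectation with respect to the Palm probability of $\Phi$. The mean cell of $\Phi$ has traffic demand $\bar\rho=\mathbf E^0[\rho(0)]$, load $\bar\theta=\mathbf E^0[\theta(0)]$, critical traffic $\bar\rho_{\mathrm c}=\bar\rho/\bar\theta$, user throughput $\bar r=\max(\bar\rho_{\mathrm c}-\bar\rho,0)$ and number of users $\bar N=\bar\rho/\bar r$, and its load equation, in the unknown $t\in[0,\infty]$, is $$t=\frac{\rho}{\lambda}\,\mathbf E\Big[1/R\Big(\frac{1/L_{X^*}(0)}{N+t\sum_{Y\in\Phi\setminus\{X^*\}}1/L_Y(0)}\Big)\Big],$$ where $X^*$ is the BS whose cell covers the origin (if several cells cover it, the corresponding terms $1/R(\cdot)$ are summed). The values of $\rho(X),\theta(X)$ and of these quantities are taken in $[0,\infty]$. For $\alpha>0$ let the rescaled network be given by $\Phi'=\{\alpha X\}_{X\in\Phi}$, $\rho'=\rho/\alpha^2$, $K'=K/\alpha$, $S_n'(y)=S_n(y/\alpha)$, with the same $P_n$, $\varphi_n$, $\beta$, $N$, $R$; write $\mathbf E'^0$ for its Palm expectation and use primes for its characteristics. Then the rescaled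 network is again a homogeneous network in the above sense. The interference factors are arbitrary; they satisfy almost surely the load equations $\varphi_X=\min(\theta(X),1)$, $X\in\Phi$, if and only if they do so in the rescaled network. In all cases $$\mathbf E'^0[\rho'(0)]=\mathbf E^0[\rho(0)],\qquad \mathbf E'^0[\theta'(0)]=\mathbf E^0[\theta(0)],$$ and consequently the mean cell characteristics of $\Phi$ and $\Phi'$ coincide: $\bar\rho'=\bar\rho$, $\bar\theta'=\bar\theta$, $\bar\rho_{\mathrm c}'=\bar\rho_{\mathrm c}$, $\bar r'=\bar r$, $\bar N'=\bar N$, and the right-hand sides of the two mean cell load equations are the same function of $t$. -/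

import Mathlib

open MeasureTheory ProbabilityTheory
open scoped ENNReal

/-- The Euclidean plane, in which the base stations and the users are located. -/
abbrev Plane : Type := EuclideanSpace ℝ (Fin 2)

/-- The half-open unit square, a set of area one. -/
def unitSquare : Set Plane := {x | ∀ i, x i ∈ Set.Ico (0 : ℝ) 1}

/-- The data of a cellular network on a sample space `Ω`; the laws they obey are collected in
`Network.IsHomogeneous`. -/
structure Network (Ω : Type*) where
  /-- The distance coefficient of the path-loss. -/
  K : ℝ
  /-- The path-loss exponent. -/
  β : ℝ
  /-- The noise power. -/
  noise : ℝ
  /-- The traffic demand per unit of surface. -/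
  demand : ℝ
  /-- The peak bit-rate as a function of the SINR. -/
  rate : ℝ≥0∞ → ℝ≥0∞
  /-- The translation flow: `shift x ω` is the realization `ω` seen from the location `x`. -/
  shift : Plane → Ω → Ω
  /-- The locations of the base stations. -/
  loc : ℤ → Ω → Plane
  /-- The emitted powers. -/
  power : ℤ → Ω → ℝ
  /-- The shadowing fields, in coordinates relative to the base station. -/
  shadow : ℤ → Ω → Plane → ℝ
  /-- The interference factors. -/
  factor : ℤ → Ω → ℝ

namespace Network

noncomputable section

variable {Ω : Type*}

/-! ### Cells and their characteristics -/

/-- The path-loss function `x ↦ (K |x|) ^ β`. -/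
def pathLoss (𝒩 : Network Ω) (x : Plane) : ℝ := (𝒩.K * ‖x‖) ^ 𝒩.β

/-- The propagation loss between the `n`-th base station and the location `y`. -/
def propLoss (𝒩 : Network Ω) (n : ℤ) (ω : Ω) (y : Plane) : ℝ :=
  𝒩.pathLoss (y - 𝒩.loc n ω) / (𝒩.power n ω * 𝒩.shadow n ω (y - 𝒩.loc n ω))

/-- The cell of the `n`-th base station. -/
def cell (𝒩 : Network Ω) (n : ℤ) (ω : Ω) : Set Plane :=
  {y | ∀ m, 𝒩.propLoss n ω y ≤ 𝒩.propLoss m ω y}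

/-- The SINR at `y` for a user served by the `n`-th base station, when the `m`-th base station
interferes with weight `w m`. Values are in `[0, ∞]`. -/
def sinrWith (𝒩 : Network Ω) (w : ℤ → ℝ≥0∞) (n : ℤ) (ω : Ω) (y : Plane) : ℝ≥0∞ :=
  (ENNReal.ofReal (𝒩.propLoss n ω y))⁻¹ /
    (ENNReal.ofReal 𝒩.noise +
      ∑' m : ℤ, if m = n then 0 else w m / ENNReal.ofReal (𝒩.propLoss m ω y))

/-- The SINR with the interference factors of the network. -/
def sinr (𝒩 : Network Ω) (n : ℤ) (ω : Ω) (y : Plane) : ℝ≥0∞ :=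
  𝒩.sinrWith (fun m => ENNReal.ofReal (𝒩.factor m ω)) n ω y

/-- The traffic demand to the cell of the `n`-th base station. -/
def traffic (𝒩 : Network Ω) (n : ℤ) (ω : Ω) : ℝ≥0∞ :=
  ENNReal.ofReal 𝒩.demand * volume (𝒩.cell n ω)

/-- The load of the cell of the `n`-th base station: the demand per unit of surface times the
integral over the cell of the inverse of the peak bit-rate. -/
def load (𝒩 : Network Ω) (n : ℤ) (ω : Ω) : ℝ≥0∞ :=
  ENNReal.ofReal 𝒩.demand * ∫⁻ y in 𝒩.cell n ω, (𝒩.rate (𝒩.sinr n ω y))⁻¹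

/-! ### Stationarity and the Palm probability -/

/-- The intensity of the point process: the mean number of base stations in the unit square,
written as the sum over the stations of the probability of being there. -/
def intensity [MeasurableSpace Ω] (𝒩 : Network Ω) (P : Measure Ω) : ℝ≥0∞ :=
  ∑' n : ℤ, P {ω | 𝒩.loc n ω ∈ unitSquare}

/-- The σ-algebra generated by the point process of locations, that is, by the numbers of points
in Borel sets. -/
@[reducible] def pointSigma (𝒩 : Network Ω) : MeasurableSpace Ω :=
  ⨆ B : {B : Set Plane // MeasurableSet B},
    MeasurableSpace.comap (fun ω => {n : ℤ | 𝒩.loc n ω ∈ B.1}.encard) ⊤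

/-- The homogeneous network model: the base stations form a simple, locally finite, stationary and
ergodic point process of positive finite intensity, the powers and the shadowing fields are i.i.d.
marks of it, and the interference factors are arbitrary marks with values in `[0, 1]`.
Stationarity of the marked point process is expressed in the usual framework of Palm calculus, by
a measurable flow which preserves the probability and translates the marked points. -/
structure IsHomogeneous [MeasurableSpace Ω] (𝒩 : Network Ω) (P : Measure Ω) : Prop where
  K_pos : 0 < 𝒩.K
  two_lt_β : 2 < 𝒩.β
  noise_nonneg : 0 ≤ 𝒩.noise
  demand_pos : 0 < 𝒩.demand
  measurable_rate : Measurable 𝒩.rate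
  shift_zero : ∀ ω, 𝒩.shift 0 ω = ω
  shift_add : ∀ x y ω, 𝒩.shift (x + y) ω = 𝒩.shift x (𝒩.shift y ω)
  measurable_shift : Measurable fun q : Plane × Ω => 𝒩.shift q.1 q.2
  measurePreserving_shift : ∀ x, MeasurePreserving (𝒩.shift x) P P
  measurable_loc : ∀ n, Measurable (𝒩.loc n)
  measurable_power : ∀ n, Measurable (𝒩.power n)
  measurable_shadow : ∀ n, Measurable fun q : Ω × Plane => 𝒩.shadow n q.1 q.2
  measurable_factor : ∀ n, Measurable (𝒩.factor n)
  simple : ∀ ω, Function.Injective fun n => 𝒩.loc n ω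
  locallyFinite : ∀ ω (r : ℝ), {n : ℤ | ‖𝒩.loc n ω‖ ≤ r}.Finite
  /-- Up to a relabelling, shifting by `x` translates the points by `-x`, with their marks. -/
  covariant : ∀ x ω, ∃ σ : Equiv.Perm ℤ, ∀ n,
    𝒩.loc (σ n) (𝒩.shift x ω) = 𝒩.loc n ω - x ∧
    𝒩.power (σ n) (𝒩.shift x ω) = 𝒩.power n ω ∧
    𝒩.shadow (σ n) (𝒩.shift x ω) = 𝒩.shadow n ω ∧
    𝒩.factor (σ n) (𝒩.shift x ω) = 𝒩.factor n ω
  /-- The point process is ergodic: its shift-invariant events are trivial. -/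
  ergodic : ∀ A : Set Ω, MeasurableSet[𝒩.pointSigma] A → (∀ x, 𝒩.shift x ⁻¹' A = A) →
    P A = 0 ∨ P A = 1
  intensity_pos : 0 < 𝒩.intensity P
  intensity_lt_top : 𝒩.intensity P < ∞
  power_pos : ∀ n ω, 0 < 𝒩.power n ω
  power_iIndep : iIndepFun 𝒩.power P
  power_identDistrib : ∀ n m, IdentDistrib (𝒩.power n) (𝒩.power m) P P
  power_indep_loc : IndepFun (fun ω n => 𝒩.power n ω) (fun ω n => 𝒩.loc n ω) P
  shadow_pos : ∀ n ω y, 0 < 𝒩.shadow n ω y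
  shadow_iIndep : iIndepFun 𝒩.shadow P
  shadow_identDistrib : ∀ n m, IdentDistrib (𝒩.shadow n) (𝒩.shadow m) P P
  shadow_indep_loc : IndepFun (fun ω n => 𝒩.shadow n ω) (fun ω n => 𝒩.loc n ω) P
  factor_mem : ∀ n ω, 𝒩.factor n ω ∈ Set.Icc (0 : ℝ) 1

/-- The Palm probability of the point process of locations: the event `A` has Palm probability
`λ⁻¹ E[#{n | X n ∈ B and shift (X n) ω ∈ A}]`, where `B` is the unit square. -/
def palm [MeasurableSpace Ω] (𝒩 : Network Ω) (P : Measure Ω) : Measure Ω :=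
  (𝒩.intensity P)⁻¹ • Measure.sum fun n : ℤ =>
    (P.restrict {ω | 𝒩.loc n ω ∈ unitSquare}).map fun ω => 𝒩.shift (𝒩.loc n ω) ω

/-- The value of a characteristic `f` at the base station located at the origin. That station is
unique because the point process is simple, and it exists almost surely under the Palm
probability. -/
def atOrigin (𝒩 : Network Ω) (f : ℤ → Ω → ℝ≥0∞) (ω : Ω) : ℝ≥0∞ :=
  ⨆ (n : ℤ) (_ : 𝒩.loc n ω = 0), f n ω

/-! ### The mean cell -/

/-- The traffic demand of the mean cell: the Palm expectation of the per-cell traffic demand. -/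
def meanTraffic [MeasurableSpace Ω] (𝒩 : Network Ω) (P : Measure Ω) : ℝ≥0∞ :=
  ∫⁻ ω, 𝒩.atOrigin 𝒩.traffic ω ∂(𝒩.palm P)

/-- The load of the mean cell: the Palm expectation of the cell load. -/
def meanLoad [MeasurableSpace Ω] (𝒩 : Network Ω) (P : Measure Ω) : ℝ≥0∞ :=
  ∫⁻ ω, 𝒩.atOrigin 𝒩.load ω ∂(𝒩.palm P)

/-- The critical traffic demand of the mean cell. -/
def meanCriticalTraffic [MeasurableSpace Ω] (𝒩 : Network Ω) (P : Measure Ω) : ℝ≥0∞ :=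
  𝒩.meanTraffic P / 𝒩.meanLoad P

/-- The user throughput of the mean cell, `max (critical traffic - traffic) 0`; the subtraction
of `[0, ∞]` is truncated at zero. -/
def meanThroughput [MeasurableSpace Ω] (𝒩 : Network Ω) (P : Measure Ω) : ℝ≥0∞ :=
  𝒩.meanCriticalTraffic P - 𝒩.meanTraffic P

/-- The number of users of the mean cell (infinite when the throughput vanishes). -/
def meanUsers [MeasurableSpace Ω] (𝒩 : Network Ω) (P : Measure Ω) : ℝ≥0∞ :=
  𝒩.meanTraffic P / 𝒩.meanThroughput P

/-- The right-hand side, as a function of the load `t`, of the load equation of the mean cell.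
The sum runs over the base stations whose cell covers the origin; it has one term when there
are no ties. -/
def meanLoadMap [MeasurableSpace Ω] (𝒩 : Network Ω) (P : Measure Ω) (t : ℝ≥0∞) : ℝ≥0∞ :=
  ENNReal.ofReal 𝒩.demand / 𝒩.intensity P *
    ∫⁻ ω, ∑' n : {n : ℤ // (0 : Plane) ∈ 𝒩.cell n ω},
      (𝒩.rate (𝒩.sinrWith (fun _ => t) n ω 0))⁻¹ ∂P

/-! ### Load equations and rescaling -/

/-- The interference factors satisfy the load equations: each of them is the probability
`min (θ(X), 1)` that the base station is active. -/
def SolvesLoadEquations [MeasurableSpace Ω] (𝒩 : Network Ω) (P : Measure Ω) : Prop :=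
  ∀ᵐ ω ∂P, ∀ n, ENNReal.ofReal (𝒩.factor n ω) = min (𝒩.load n ω) 1

/-- The network rescaled by `α`. The flow is reparametrized so that it acts by translations on the
rescaled locations. -/
def rescale (𝒩 : Network Ω) (α : ℝ) : Network Ω where
  K := 𝒩.K / α
  β := 𝒩.β
  noise := 𝒩.noise
  demand := 𝒩.demand / α ^ 2
  rate := 𝒩.rate
  shift := fun x => 𝒩.shift (α⁻¹ • x)
  loc := fun n ω => α • 𝒩.loc n ω
  power := 𝒩.power
  shadow := fun n ω y => 𝒩.shadow n ω (α⁻¹ • y)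
  factor := 𝒩.factor

end

end Network

/-! The product of `K` and the distance to a station is unchanged by the rescaling, so the
propagation loss at `y` becomes the original loss at `α⁻¹ • y`. Cells are thus dilated by `α`, areas
are multiplied by `α ^ 2`, and the division of the demand by `α ^ 2` compensates exactly: traffic
and load of every cell agree realization by realization, hence so do the load equations.

What remains is probabilistic. The rescaled Palm probability counts stations in a square which, in
original coordinates, has side `α⁻¹`. For a fixed event the Campbell measure is translation
invariant and finite on compact sets, hence a multiple of Lebesgue measure
(`campbell_smul_unitSquare`). The change of square therefore multiplies it by `α⁻²`, and the
intensity by the same factor; the ratio is unchanged (`palm_rescale`). -/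

namespace Network

variable {Ω : Type*}

/-! ### Pointwise effect of the rescaling -/

theorem rescale_propLoss (𝒩 : Network Ω) {α : ℝ} (hα : 0 < α) (n : ℤ) (ω : Ω) (y : Plane) :
    (𝒩.rescale α).propLoss n ω y = 𝒩.propLoss n ω (α⁻¹ • y) := by
  have h : α⁻¹ • (y - α • 𝒩.loc n ω) = α⁻¹ • y - 𝒩.loc n ω := by
    rw [smul_sub, inv_smul_smul₀ hα.ne']
  have h' : 𝒩.K / α * ‖y - α • 𝒩.loc n ω‖ = 𝒩.K * ‖α⁻¹ • y - 𝒩.loc n ω‖ := by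
    rw [← h, norm_smul, Real.norm_of_nonneg (inv_nonneg.2 hα.le)]
    ring
  simp only [propLoss, pathLoss, rescale, h, h']

theorem rescale_cell (𝒩 : Network Ω) {α : ℝ} (hα : 0 < α) (n : ℤ) (ω : Ω) :
    (𝒩.rescale α).cell n ω = (fun y : Plane => α⁻¹ • y) ⁻¹' 𝒩.cell n ω := by
  ext y
  simp only [cell, rescale_propLoss 𝒩 hα, Set.mem_ofPred_eq, Set.mem_preimage]

theorem rescale_sinrWith (𝒩 : Network Ω) {α : ℝ} (hα : 0 < α) (w : ℤ → ℝ≥0∞) (n : ℤ) (ω : Ω)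
    (y : Plane) : (𝒩.rescale α).sinrWith w n ω y = 𝒩.sinrWith w n ω (α⁻¹ • y) := by
  simp only [sinrWith, rescale_propLoss 𝒩 hα]
  rfl

theorem rescale_sinr (𝒩 : Network Ω) {α : ℝ} (hα : 0 < α) (n : ℤ) (ω : Ω) (y : Plane) :
    (𝒩.rescale α).sinr n ω y = 𝒩.sinr n ω (α⁻¹ • y) :=
  rescale_sinrWith 𝒩 hα _ n ω y

/-- Change of variables for a dilation of the plane, without measurability assumptions. -/
theorem setLIntegral_comp_inv_smul {α : ℝ} (hα : 0 < α) (C : Set Plane) (f : Plane → ℝ≥0∞) :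
    ∫⁻ y in (fun y : Plane => α⁻¹ • y) ⁻¹' C, f (α⁻¹ • y)
      = ENNReal.ofReal (α ^ 2) * ∫⁻ y in C, f y := by
  -- Taking the dilation as a measurable equivalence makes the change of variables valid for
  -- arbitrary `f` and `C`.
  let g : Plane ≃ᵐ Plane := MeasurableEquiv.smul₀ α⁻¹ (inv_ne_zero hα.ne')
  have hg : (volume : Measure Plane).map g = ENNReal.ofReal (α ^ 2) • volume := by
    have := Measure.map_addHaar_smul (volume : Measure Plane) (inv_ne_zero hα.ne')
    simp only [finrank_euclideanSpace, Fintype.card_fin, inv_pow, inv_inv,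
      abs_of_pos (pow_pos hα 2)] at this
    exact this
  calc ∫⁻ y in (fun y : Plane => α⁻¹ • y) ⁻¹' C, f (α⁻¹ • y)
      = ∫⁻ y, f y ∂((volume.restrict (g ⁻¹' C)).map g) := (lintegral_map_equiv f g).symm
    _ = ENNReal.ofReal (α ^ 2) * ∫⁻ y in C, f y := by
      rw [← g.restrict_map, hg, Measure.restrict_smul, lintegral_smul_measure, smul_eq_mul]

theorem ofReal_div_sq_mul {d α : ℝ} (hα : 0 < α) (c : ℝ≥0∞) :
    ENNReal.ofReal (d / α ^ 2) * (ENNReal.ofReal (α ^ 2) * c) = ENNReal.ofReal d * c := by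
  have h2 : 0 < α ^ 2 := pow_pos hα 2
  rw [← mul_assoc, ← ENNReal.ofReal_mul' h2.le, div_mul_cancel₀ d h2.ne']

theorem rescale_load (𝒩 : Network Ω) {α : ℝ} (hα : 0 < α) :
    (𝒩.rescale α).load = 𝒩.load := by
  ext n ω
  simp only [load, rescale_cell 𝒩 hα, rescale_sinr 𝒩 hα]
  exact (congrArg _ (setLIntegral_comp_inv_smul hα (𝒩.cell n ω)
    fun y => (𝒩.rate (𝒩.sinr n ω y))⁻¹)).trans (ofReal_div_sq_mul hα _)

theorem rescale_traffic (𝒩 : Network Ω) {α : ℝ} (hα : 0 < α) :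
    (𝒩.rescale α).traffic = 𝒩.traffic := by
  ext n ω
  have h := setLIntegral_comp_inv_smul hα (𝒩.cell n ω) fun _ => 1
  rw [setLIntegral_one, setLIntegral_one] at h
  simp only [traffic, rescale_cell 𝒩 hα]
  exact (congrArg _ h).trans (ofReal_div_sq_mul hα _)

theorem rescale_atOrigin (𝒩 : Network Ω) {α : ℝ} (hα : 0 < α) (f : ℤ → Ω → ℝ≥0∞) :
    (𝒩.rescale α).atOrigin f = 𝒩.atOrigin f := by
  ext ω
  simp only [atOrigin, rescale, smul_eq_zero, hα.ne', false_or]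

/-- Dilation permutes the Borel sets, so both families of counting variables coincide. This
transfers ergodicity. -/
theorem rescale_pointSigma (𝒩 : Network Ω) {α : ℝ} (hα : 0 < α) :
    (𝒩.rescale α).pointSigma = 𝒩.pointSigma := by
  refine le_antisymm (iSup_le fun B => ?_) (iSup_le fun B => ?_)
  · exact le_iSup (fun B : {B : Set Plane // MeasurableSet B} =>
      MeasurableSpace.comap (fun ω => {n : ℤ | 𝒩.loc n ω ∈ B.1}.encard) ⊤)
      ⟨(fun y : Plane => α • y) ⁻¹' B.1, measurable_const_smul α B.2⟩
  · refine le_of_eq_of_le ?_ (le_iSup (fun B : {B : Set Plane // MeasurableSet B} =>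
      MeasurableSpace.comap (fun ω => {n : ℤ | (𝒩.rescale α).loc n ω ∈ B.1}.encard) ⊤)
      ⟨(fun y : Plane => α⁻¹ • y) ⁻¹' B.1, measurable_const_smul α⁻¹ B.2⟩)
    simp only [rescale, Set.mem_preimage, inv_smul_smul₀ hα.ne']

/-! ### The Campbell measure -/

theorem measurableSet_unitSquare : MeasurableSet unitSquare := by
  have : unitSquare = ⋂ i, (fun x : Plane => x i) ⁻¹' Set.Ico (0 : ℝ) 1 := by
    ext x; simp [unitSquare]
  rw [this]
  exact MeasurableSet.iInter fun i =>
    (show Measurable fun x : Plane => x i by fun_prop) measurableSet_Ico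

theorem interior_unitSquare_nonempty : (interior unitSquare).Nonempty := by
  have ho : IsOpen (⋂ i, (fun x : Plane => x i) ⁻¹' Set.Ioo (0 : ℝ) 1) :=
    isOpen_iInter_of_finite fun i =>
      isOpen_Ioo.preimage (show Continuous fun x : Plane => x i by fun_prop)
  refine ⟨WithLp.toLp 2 fun _ => 1 / 2, interior_maximal (fun x hx i => ?_) ho ?_⟩
  · exact Set.Ioo_subset_Ico_self (Set.mem_iInter.1 hx i)
  · refine Set.mem_iInter.2 fun i => ?_
    norm_num [Set.mem_preimage]

variable [MeasurableSpace Ω]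

/-- The section at the event `A` of the Campbell measure: the mean number of base stations in a
set from which the realization, seen from the station, belongs to `A`. -/
noncomputable def campbell (𝒩 : Network Ω) (P : Measure Ω) (A : Set Ω) : Measure Plane :=
  Measure.sum fun n : ℤ => (P.restrict {ω | 𝒩.shift (𝒩.loc n ω) ω ∈ A}).map (𝒩.loc n)

namespace IsHomogeneous

variable {𝒩 : Network Ω} {P : Measure Ω}

theorem measurable_shift_loc (h : 𝒩.IsHomogeneous P) (n : ℤ) :
    Measurable fun ω => 𝒩.shift (𝒩.loc n ω) ω :=
  h.measurable_shift.comp ((h.measurable_loc n).prodMk measurable_id)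

theorem campbell_apply (h : 𝒩.IsHomogeneous P) (A : Set Ω) {B : Set Plane}
    (hB : MeasurableSet B) :
    𝒩.campbell P A B = ∑' n, P {ω | 𝒩.loc n ω ∈ B ∧ 𝒩.shift (𝒩.loc n ω) ω ∈ A} := by
  rw [campbell, Measure.sum_apply _ hB]
  refine tsum_congr fun n => ?_
  rw [Measure.map_apply (h.measurable_loc n) hB,
    Measure.restrict_apply (h.measurable_loc n hB)]
  rfl

/-- The relabelling in `covariant` depends on `ω`, so it can reindex the sum only inside the
expectation. -/
theorem campbell_apply_eq_lintegral (h : 𝒩.IsHomogeneous P) {A : Set Ω} (hA : MeasurableSet A)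
    {B : Set Plane} (hB : MeasurableSet B) :
    𝒩.campbell P A B = ∫⁻ ω, ∑' n,
      {ω | 𝒩.loc n ω ∈ B ∧ 𝒩.shift (𝒩.loc n ω) ω ∈ A}.indicator 1 ω ∂P := by
  have hm : ∀ n, MeasurableSet {ω | 𝒩.loc n ω ∈ B ∧ 𝒩.shift (𝒩.loc n ω) ω ∈ A} := fun n =>
    (h.measurable_loc n hB).inter (h.measurable_shift_loc n hA)
  rw [h.campbell_apply A hB, lintegral_tsum fun n =>
    (measurable_one.indicator (hm n)).aemeasurable]
  exact tsum_congr fun n => (lintegral_indicator_one (hm n)).symm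

/-- The flow by `x` moves each station by `-x` but not the view from it: moving by `x` and then to
the displaced station amounts to moving directly to the original one. The counts thus agree
pathwise, and `P` is preserved by the flow. -/
theorem isAddLeftInvariant_campbell (h : 𝒩.IsHomogeneous P) {A : Set Ω} (hA : MeasurableSet A) :
    (𝒩.campbell P A).IsAddLeftInvariant := by
  refine ⟨fun x => Measure.ext fun B hB => ?_⟩
  rw [Measure.map_apply (measurable_const_add x) hB,
    h.campbell_apply_eq_lintegral hA (measurable_const_add x hB),
    h.campbell_apply_eq_lintegral hA hB]
  have hm : ∀ n, MeasurableSet {ω | 𝒩.loc n ω ∈ (fun y => x + y) ⁻¹' B ∧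
      𝒩.shift (𝒩.loc n ω) ω ∈ A} := fun n =>
    (h.measurable_loc n (measurable_const_add x hB)).inter (h.measurable_shift_loc n hA)
  rw [← (h.measurePreserving_shift x).lintegral_comp
    (Measurable.tsum fun n => measurable_one.indicator (hm n))]
  refine lintegral_congr fun ω => ?_
  obtain ⟨σ, hσ⟩ := h.covariant x ω
  rw [← σ.tsum_eq]
  refine tsum_congr fun n => ?_
  have h1 : 𝒩.loc (σ n) (𝒩.shift x ω) = 𝒩.loc n ω - x := (hσ n).1
  have h2 : 𝒩.shift (𝒩.loc n ω - x) (𝒩.shift x ω) = 𝒩.shift (𝒩.loc n ω) ω := by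
    rw [← h.shift_add, sub_add_cancel]
  classical
  simp only [Set.indicator_apply, Set.mem_ofPred_eq, Set.mem_preimage, h1, h2, add_sub_cancel,
    Pi.one_apply]

theorem campbell_univ_unitSquare (h : 𝒩.IsHomogeneous P) :
    𝒩.campbell P Set.univ unitSquare = 𝒩.intensity P := by
  simp only [h.campbell_apply _ measurableSet_unitSquare, intensity, Set.mem_univ, and_true]

theorem campbell_unitSquare_lt_top (h : 𝒩.IsHomogeneous P) (A : Set Ω) :
    𝒩.campbell P A unitSquare < ∞ := by
  refine lt_of_le_of_lt ?_ h.intensity_lt_top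
  rw [h.campbell_apply _ measurableSet_unitSquare]
  exact ENNReal.tsum_le_tsum fun n => measure_mono fun ω hω => hω.1

/-- The sections of the Campbell measure scale like the Lebesgue measure. -/
theorem campbell_smul_unitSquare (h : 𝒩.IsHomogeneous P) {A : Set Ω} (hA : MeasurableSet A)
    {α : ℝ} (hα : 0 < α) :
    𝒩.campbell P A ((fun y : Plane => α • y) ⁻¹' unitSquare)
      = (ENNReal.ofReal (α ^ 2))⁻¹ * 𝒩.campbell P A unitSquare := by
  have := h.isAddLeftInvariant_campbell hA
  -- By invariance, finiteness on one set with nonempty interior gives finiteness on compact sets,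
  -- as required for uniqueness of Haar measure.
  have : IsFiniteMeasureOnCompacts (𝒩.campbell P A) :=
    ⟨fun _ hK => measure_lt_top_of_isCompact_of_isAddLeftInvariant' interior_unitSquare_nonempty
      (h.campbell_unitSquare_lt_top A).ne hK⟩
  rw [Measure.isAddLeftInvariant_eq_smul (𝒩.campbell P A) (volume : Measure Plane)]
  simp only [Measure.smul_apply]
  rw [Measure.addHaar_preimage_smul _ hα.ne', finrank_euclideanSpace, Fintype.card_fin,
    abs_of_pos (inv_pos.2 (pow_pos hα 2)), ENNReal.ofReal_inv_of_pos (pow_pos hα 2),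
    mul_smul_comm]

theorem intensity_rescale (h : 𝒩.IsHomogeneous P) {α : ℝ} (hα : 0 < α) :
    (𝒩.rescale α).intensity P = (ENNReal.ofReal (α ^ 2))⁻¹ * 𝒩.intensity P := by
  rw [← h.campbell_univ_unitSquare, ← h.campbell_smul_unitSquare MeasurableSet.univ hα,
    h.campbell_apply _ (measurable_const_smul α measurableSet_unitSquare)]
  simp only [intensity, rescale, Set.mem_univ, and_true, Set.mem_preimage]

theorem palm_apply (h : 𝒩.IsHomogeneous P) {A : Set Ω} (hA : MeasurableSet A) :
    𝒩.palm P A = (𝒩.intensity P)⁻¹ * 𝒩.campbell P A unitSquare := by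
  rw [palm, Measure.smul_apply, smul_eq_mul, Measure.sum_apply _ hA,
    h.campbell_apply _ measurableSet_unitSquare]
  congr 1
  refine tsum_congr fun n => ?_
  rw [Measure.map_apply (h.measurable_shift_loc n) hA,
    Measure.restrict_apply (h.measurable_shift_loc n hA), Set.inter_comm]
  rfl

/-! ### The rescaled network is homogeneous -/

theorem rescale (h : 𝒩.IsHomogeneous P) {α : ℝ} (hα : 0 < α) :
    (𝒩.rescale α).IsHomogeneous P := by
  have hα2 : ENNReal.ofReal (α ^ 2) ≠ 0 := (ENNReal.ofReal_pos.2 (pow_pos hα 2)).ne'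
  -- Independence and equality of laws pass through measurable maps of the function spaces, whose
  -- σ-algebra is the product one.
  have hdil : Measurable fun (f : Plane → ℝ) (y : Plane) => f (α⁻¹ • y) :=
    measurable_pi_lambda _ fun y => measurable_pi_apply _
  have hdils : Measurable fun (f : ℤ → Plane → ℝ) (n : ℤ) (y : Plane) => f n (α⁻¹ • y) :=
    measurable_pi_lambda _ fun n => hdil.comp (measurable_pi_apply n)
  have hlocs : Measurable fun (x : ℤ → Plane) (n : ℤ) => α • x n :=
    measurable_pi_lambda _ fun n => (measurable_pi_apply n).const_smul α
  exact
  { K_pos := div_pos h.K_pos hα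
    two_lt_β := h.two_lt_β
    noise_nonneg := h.noise_nonneg
    demand_pos := div_pos h.demand_pos (pow_pos hα 2)
    measurable_rate := h.measurable_rate
    shift_zero := fun ω => by simp only [Network.rescale, smul_zero, h.shift_zero]
    shift_add := fun x y ω => by simp only [Network.rescale, smul_add, h.shift_add]
    measurable_shift := h.measurable_shift.comp
      ((measurable_fst.const_smul α⁻¹).prodMk measurable_snd)
    measurePreserving_shift := fun x => h.measurePreserving_shift (α⁻¹ • x)
    measurable_loc := fun n => (h.measurable_loc n).const_smul α
    measurable_power := h.measurable_power
    measurable_shadow := fun n => (h.measurable_shadow n).comp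
      (measurable_fst.prodMk (measurable_snd.const_smul α⁻¹))
    measurable_factor := h.measurable_factor
    simple := fun ω n m hnm => h.simple ω (smul_right_injective Plane hα.ne' hnm)
    locallyFinite := fun ω r => (h.locallyFinite ω (r / α)).subset fun n hn => by
      have hn' : ‖α • 𝒩.loc n ω‖ ≤ r := hn
      rw [norm_smul, Real.norm_of_nonneg hα.le] at hn'
      exact (le_div_iff₀' hα).2 hn'
    covariant := fun x ω => by
      obtain ⟨σ, hσ⟩ := h.covariant (α⁻¹ • x) ω
      refine ⟨σ, fun n => ?_⟩
      obtain ⟨h1, h2, h3, h4⟩ := hσ n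
      refine ⟨?_, h2, funext fun y => congrFun h3 (α⁻¹ • y), h4⟩
      simp only [Network.rescale, h1, smul_sub, smul_inv_smul₀ hα.ne']
    ergodic := fun A hA hinv => by
      rw [rescale_pointSigma 𝒩 hα] at hA
      refine h.ergodic A hA fun x => ?_
      have := hinv (α • x)
      simpa only [Network.rescale, inv_smul_smul₀ hα.ne'] using this
    intensity_pos := by
      rw [h.intensity_rescale hα]
      exact ENNReal.mul_pos (ENNReal.inv_ne_zero.2 ENNReal.ofReal_ne_top) h.intensity_pos.ne'
    intensity_lt_top := by
      rw [h.intensity_rescale hα]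
      exact ENNReal.mul_lt_top (ENNReal.inv_lt_top.2 (pos_iff_ne_zero.2 hα2)) h.intensity_lt_top
    power_pos := h.power_pos
    power_iIndep := h.power_iIndep
    power_identDistrib := h.power_identDistrib
    power_indep_loc := h.power_indep_loc.comp measurable_id hlocs
    shadow_pos := fun n ω y => h.shadow_pos n ω _
    shadow_iIndep := h.shadow_iIndep.comp (fun _ f y => f (α⁻¹ • y)) fun _ => hdil
    shadow_identDistrib := fun n m => (h.shadow_identDistrib n m).comp hdil
    shadow_indep_loc := h.shadow_indep_loc.comp hdils hlocs
    factor_mem := h.factor_mem }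

/-- The Palm probability is the same whether the stations are counted in the unit square or in
the unit square of the rescaled network. -/
theorem palm_rescale (h : 𝒩.IsHomogeneous P) {α : ℝ} (hα : 0 < α) :
    (𝒩.rescale α).palm P = 𝒩.palm P := by
  have hα2 : ENNReal.ofReal (α ^ 2) ≠ 0 := (ENNReal.ofReal_pos.2 (pow_pos hα 2)).ne'
  refine Measure.ext fun A hA => ?_
  have hc : (𝒩.rescale α).campbell P A unitSquare
      = (ENNReal.ofReal (α ^ 2))⁻¹ * 𝒩.campbell P A unitSquare := by
    rw [← h.campbell_smul_unitSquare hA hα, (h.rescale hα).campbell_apply _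
      measurableSet_unitSquare,
      h.campbell_apply _ (measurable_const_smul α measurableSet_unitSquare)]
    -- The rescaled flow at `α • X` is the original flow at `X`, so the view from a station is the
    -- same.
    simp only [Network.rescale, inv_smul_smul₀ hα.ne', Set.mem_preimage]
  rw [(h.rescale hα).palm_apply hA, h.palm_apply hA, hc, h.intensity_rescale hα,
    ENNReal.mul_inv (.inr h.intensity_lt_top.ne) (.inr h.intensity_pos.ne'), inv_inv]
  calc ENNReal.ofReal (α ^ 2) * (𝒩.intensity P)⁻¹ *
        ((ENNReal.ofReal (α ^ 2))⁻¹ * 𝒩.campbell P A unitSquare)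
      = (ENNReal.ofReal (α ^ 2) * (ENNReal.ofReal (α ^ 2))⁻¹) *
        ((𝒩.intensity P)⁻¹ * 𝒩.campbell P A unitSquare) := by ring
    _ = _ := by rw [ENNReal.mul_inv_cancel hα2 ENNReal.ofReal_ne_top, one_mul]

/-! ### Invariance of the mean cell -/

theorem meanTraffic_rescale (h : 𝒩.IsHomogeneous P) {α : ℝ} (hα : 0 < α) :
    (𝒩.rescale α).meanTraffic P = 𝒩.meanTraffic P := by
  rw [meanTraffic, meanTraffic, h.palm_rescale hα, rescale_traffic 𝒩 hα, rescale_atOrigin 𝒩 hα]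

theorem meanLoad_rescale (h : 𝒩.IsHomogeneous P) {α : ℝ} (hα : 0 < α) :
    (𝒩.rescale α).meanLoad P = 𝒩.meanLoad P := by
  rw [meanLoad, meanLoad, h.palm_rescale hα, rescale_load 𝒩 hα, rescale_atOrigin 𝒩 hα]

/-- The origin is fixed by dilation, so the integrand is unchanged; demand and intensity both scale
by `α⁻²`, which cancels in the prefactor. -/
theorem meanLoadMap_rescale (h : 𝒩.IsHomogeneous P) {α : ℝ} (hα : 0 < α) (t : ℝ≥0∞) :
    (𝒩.rescale α).meanLoadMap P t = 𝒩.meanLoadMap P t := by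
  have hα2 : ENNReal.ofReal (α ^ 2) ≠ 0 := (ENNReal.ofReal_pos.2 (pow_pos hα 2)).ne'
  have hd : ENNReal.ofReal (𝒩.rescale α).demand / (𝒩.rescale α).intensity P
      = ENNReal.ofReal 𝒩.demand / 𝒩.intensity P := by
    have hdem : ENNReal.ofReal (𝒩.rescale α).demand
        = (ENNReal.ofReal (α ^ 2))⁻¹ * ENNReal.ofReal 𝒩.demand := by
      rw [Network.rescale, ENNReal.ofReal_div_of_pos (pow_pos hα 2), ENNReal.div_eq_inv_mul]
    rw [h.intensity_rescale hα, hdem]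
    exact ENNReal.mul_div_mul_left _ _ (ENNReal.inv_ne_zero.2 ENNReal.ofReal_ne_top)
      (ENNReal.inv_ne_top.2 hα2)
  rw [meanLoadMap, meanLoadMap, hd]
  congr 1
  refine lintegral_congr fun ω => ?_
  have hc : ∀ n, (0 : Plane) ∈ (𝒩.rescale α).cell n ω ↔ (0 : Plane) ∈ 𝒩.cell n ω := fun n => by
    rw [rescale_cell 𝒩 hα, Set.mem_preimage, smul_zero]
  rw [← (Equiv.subtypeEquivRight hc).tsum_eq]
  refine tsum_congr fun n => ?_
  rw [rescale_sinrWith 𝒩 hα, smul_zero]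
  rfl

end IsHomogeneous

end Network

theorem corollary2 {Ω : Type*} [MeasurableSpace Ω] (P : Measure Ω) [IsProbabilityMeasure P]
    (𝒩 : Network Ω) (h𝒩 : 𝒩.IsHomogeneous P) (α : ℝ) (hα : 0 < α) :
    (𝒩.rescale α).IsHomogeneous P ∧
    ((𝒩.rescale α).SolvesLoadEquations P ↔ 𝒩.SolvesLoadEquations P) ∧
    (𝒩.rescale α).meanTraffic P = 𝒩.meanTraffic P ∧
    (𝒩.rescale α).meanLoad P = 𝒩.meanLoad P ∧
    (𝒩.rescale α).meanCriticalTraffic P = 𝒩.meanCriticalTraffic P ∧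
    (𝒩.rescale α).meanThroughput P = 𝒩.meanThroughput P ∧
    (𝒩.rescale α).meanUsers P = 𝒩.meanUsers P ∧
    ∀ t : ℝ≥0∞, (𝒩.rescale α).meanLoadMap P t = 𝒩.meanLoadMap P t := by
  have hT := h𝒩.meanTraffic_rescale hα
  have hL := h𝒩.meanLoad_rescale hα
  refine ⟨h𝒩.rescale hα, ?_, hT, hL, ?_, ?_, ?_, h𝒩.meanLoadMap_rescale hα⟩
  · rw [Network.SolvesLoadEquations, Network.rescale_load 𝒩 hα]
    rfl
  · simp only [Network.meanCriticalTraffic, hT, hL]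
  · simp only [Network.meanThroughput, Network.meanCriticalTraffic, hT, hL]
  · simp only [Network.meanUsers, Network.meanThroughput, Network.meanCriticalTraffic, hT, hL]
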